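/- **Lemma (strong duality).** Let $p\in[1,\infty)$, let $\|\cdot\|$ be any norm on $\mathbb R^{d_y}$ (for instance the $\ell_p$-norm), let $\mathcal Y\subseteq\mathbb R^{d_y}$ be closed and convex, let $\mathcal Z$ be a subset of a topological space, and let $c:\mathcal Z\times\mathcal Y\to\mathbb R$ be such that - for each $z\in\mathcal Z$ the function $c(z,\cdot)$ is concave on $\mathcal Y$ and Lipschitz with some finite constant $L_z$; - for each $y\in\mathcal Y$ the function $c(\cdot,y)$ is upper semicontinuous on $\mathcal Z$; - there is $0\le L_{c,p}<\infty$ with $|c(z,y)|\le L_{c,p}(1+\|y\|^p)$ for all $z\in\mathcal Z$, $y\in\mathcal Y$. Let $(x_i,y_i)\in\mathbb R^{d_x}\times\mathcal Y$, $i=1,\dots,n$, be samples, $x\in\mathbb R^{d_x}$, $h>0$ and $K:\mathbb R^{d_x}\to[0,\infty)$ with $\sum_{j}K(\frac{x-x_j}{h})>0$. Put $$w_i=\frac{K(\frac{x-x_i}{h})}{\sum_{j=1}^nK(\frac{x-x_j}{h})},\qquad \hat\mu=\sum_{i=1}^n w_i\delta_{y_i}.$$ For $\varepsilon\ge0$ let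 $B_\varepsilon^p(\hat\mu)$ be the set of probability measures $\mu$ on $\mathcal Y$ with $\mathcal W_p(\hat\mu,\mu)\le\varepsilon$, where $\mathcal W_p(\hat\mu,\mu)=\inf_\gamma\left(\int\|a-b\|^p\,\gamma(da,db)\right)^{1/p}$ over all couplings $\gamma$ of $\hat\mu$ and $\mu$. For $z\in\mathcal Z$ put $$c_P(z)=\sup_{\mu\in B_\varepsilon^p(\hat\mu)}\mathbb E_\mu[c(z,Y)],\qquad c_D(z)=\inf_{\lambda\ge0}\varphi_z(\lambda),\qquad \varphi_z(\lambda)=\lambda\varepsilon^p-\mathbb E_{\xi\sim\hat\mu}\Big[\inf_{y\in\mathcal Y}\big(\lambda\|\xi-y\|^p-c(z,y)\big)\Big],$$ with values in the extended reals (and $0\cdot\infty=0$). Then, for every $z\in\mathcal Z$: 1. $c(z,\cdot)$ is integrable with respect to every $\mu\in B_\varepsilon^p(\hat\mu)$; for all $\lambda\ge0$, $\varphi_z(\lambda)=\lambda\varepsilon^p+\sum_{i=1}^nw_i\sup_{y\in\mathcal Y}[c(z,y)-\lambda\|y-y_i\|^p]$; and $$c_P(z)=c_D(z)=\inf_{\lambda\ge0}\Big\{\lambda\varepsilon^p+\sum_{i=1}^nw_i\sup_{y\in\mathcal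 Y}[c(z,y)-\lambda\|y-y_i\|^p]\Big\}=\sup_{\xi_1,\dots,\xi_n\in\mathcal Y}\Big\{\sum_{i=1}^nw_ic(z,\xi_i):\ \sum_{i=1}^nw_i\|\xi_i-y_i\|^p\le\varepsilon^p\Big\}.$$ 2. If $\varepsilon>0$, the infimum over $\lambda\ge0$ is attained. 3. There is a worst-case distribution $\tilde\mu\in B_\varepsilon^p(\hat\mu)$, i.e. $\mathbb E_{\tilde\mu}[c(z,Y)]=c_P(z)$, supported on at most $n+1$ points and of the form $$\tilde\mu=\sum_{i\ne i_0}w_i\delta_{y_i^*}+w^*\delta_{y^*_{1i_0}}+(w_{i_0}-w^*)\delta_{y^*_{2i_0}},\qquad i_0\in\{1,\dots,n\},\ w^*\in[0,w_{i_0}],$$ with all these points in $\mathcal Y$, such that for every minimizer $\lambda^*\ge 0$ of $\varphi_z$ on $[0,\infty)$: $y_i^*\in\arg\min_{y\in\mathcal Y}\{\lambda^*\|y-y_i\|^p-c(z,y)\}$ for all $i\ne i_0$ with $w_i>0$, and $y^*_{1i_0},y^*_{2i_0}\in\arg\min_{y\in\mathcal Y}\{\lambda^*\|y-y_{i_0}\|^p-c(z,y)\}$.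 -/

import Mathlib

open scoped NNReal ENNReal

namespace KernelDRO

noncomputable section

/-- Nadaraya-Watson weight `K((x - x_i)/h) / ∑_j K((x - x_j)/h)` of the `i`-th sample. -/
def nwWeight {dx n : ℕ} (K : EuclideanSpace ℝ (Fin dx) → ℝ) (h : ℝ)
    (xs : Fin n → EuclideanSpace ℝ (Fin dx)) (x : EuclideanSpace ℝ (Fin dx)) (i : Fin n) : ℝ :=
  K (h⁻¹ • (x - xs i)) / ∑ j, K (h⁻¹ • (x - xs j))

/-- The weighted empirical distribution `∑ i, w_i δ_{y_i}`. -/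
def weightedEmpirical {E : Type*} [MeasurableSpace E] {n : ℕ} (w : Fin n → ℝ) (y : Fin n → E) :
    MeasureTheory.Measure E :=
  ∑ i, ENNReal.ofReal (w i) • MeasureTheory.Measure.dirac (y i)

/-- The type-`p` Wasserstein distance: infimum of `(∫ ‖a - b‖ ^ p dξ(a, b)) ^ (1 / p)` over all
couplings `ξ` of `μ` and `ν`, as an extended nonnegative real. -/
def wassersteinDist {E : Type*} [NormedAddCommGroup E] [MeasurableSpace E] (p : ℝ)
    (μ ν : MeasureTheory.Measure E) : ℝ≥0∞ :=
  ⨅ (ξ : MeasureTheory.Measure (E × E)) (_ : ξ.map Prod.fst = μ ∧ ξ.map Prod.snd = ν),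
    (∫⁻ q, ‖q.1 - q.2‖ₑ ^ p ∂ξ) ^ (1 / p)

/-- The Wasserstein ball of radius `ε` around `ν` among the probability distributions on `Y`
(probability measures on the ambient space that give no mass to the complement of `Y`). -/
def wassersteinBall {E : Type*} [NormedAddCommGroup E] [MeasurableSpace E] (Y : Set E) (p ε : ℝ)
    (ν : MeasureTheory.Measure E) : Set (MeasureTheory.Measure E) :=
  {μ | MeasureTheory.IsProbabilityMeasure μ ∧ μ Yᶜ = 0 ∧
    wassersteinDist p ν μ ≤ ENNReal.ofReal ε}

/-- The assumption on the cost `c (z, y)`, `z ∈ Z`, `y ∈ Y`. The cost is real valued, so that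
`c (z, ·)` is proper as soon as `Y` is nonempty. -/
structure CostAssumption {D E : Type*} [TopologicalSpace D] [NormedAddCommGroup E]
    [NormedSpace ℝ E] (Z : Set D) (Y : Set E) (c : D → E → ℝ) (p : ℝ) : Prop where
  isClosed : IsClosed Y
  convex : Convex ℝ Y
  lipschitz : ∀ z ∈ Z, ∃ L : ℝ≥0, LipschitzOnWith L (c z) Y
  concave : ∀ z ∈ Z, ConcaveOn ℝ Y (c z)
  usc : ∀ y ∈ Y, UpperSemicontinuousOn (fun z => c z y) Z
  growth : ∃ L : ℝ, 0 ≤ L ∧ ∀ z ∈ Z, ∀ y ∈ Y, |c z y| ≤ L * (1 + ‖y‖ ^ p)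

/-- Worst-case expectation of `f` over the Wasserstein ball, as an extended real. -/
def primalValue {E : Type*} [NormedAddCommGroup E] [MeasurableSpace E] (Y : Set E) (p ε : ℝ)
    (ν : MeasureTheory.Measure E) (f : E → ℝ) : EReal :=
  ⨆ μ ∈ wassersteinBall Y p ε ν, ((∫ y, f y ∂μ : ℝ) : EReal)

/-- Expectation of an extended-real-valued function: the integral of the positive part minus the
integral of the negative part. -/
def extExpectation {E : Type*} [MeasurableSpace E] (ν : MeasureTheory.Measure E)
    (g : E → EReal) : EReal :=
  ((∫⁻ u, (g u).toENNReal ∂ν : ℝ≥0∞) : EReal) - ((∫⁻ u, (-g u).toENNReal ∂ν : ℝ≥0∞) : EReal)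

/-- The dual objective `λ ε ^ p - E_{ξ ∼ ν} [inf_{y ∈ Y} (λ ‖ξ - y‖ ^ p - f y)]`. -/
def dualObjective {E : Type*} [NormedAddCommGroup E] [MeasurableSpace E] (Y : Set E) (p ε : ℝ)
    (ν : MeasureTheory.Measure E) (f : E → ℝ) (lam : ℝ) : EReal :=
  ((lam * ε ^ p : ℝ) : EReal) -
    extExpectation ν (fun u => ⨅ y ∈ Y, ((lam * ‖u - y‖ ^ p - f y : ℝ) : EReal))

/-- The dual value: infimum of the dual objective over `λ ≥ 0`. -/
def dualValue {E : Type*} [NormedAddCommGroup E] [MeasurableSpace E] (Y : Set E) (p ε : ℝ)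
    (ν : MeasureTheory.Measure E) (f : E → ℝ) : EReal :=
  ⨅ lam ∈ Set.Ici (0 : ℝ), dualObjective Y p ε ν f lam

/-- The finite-dimensional problem: supremum of `∑ i, w_i f (ξ_i)` over `ξ_i ∈ Y` with
`∑ i, w_i ‖ξ_i - y_i‖ ^ p ≤ ε ^ p`. -/
def perturbationValue {E : Type*} [NormedAddCommGroup E] (Y : Set E) (p ε : ℝ) {n : ℕ}
    (w : Fin n → ℝ) (y : Fin n → E) (f : E → ℝ) : EReal :=
  ⨆ ξ ∈ {ξ : Fin n → E | (∀ i, ξ i ∈ Y) ∧ ∑ i, w i * ‖ξ i - y i‖ ^ p ≤ ε ^ p},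
    ((∑ i, w i * f (ξ i) : ℝ) : EReal)

/-- The set of minimizers over `Y` of `v ↦ λ ‖v - u‖ ^ p - f v`. -/
def innerArgmin {E : Type*} [NormedAddCommGroup E] (Y : Set E) (p : ℝ) (f : E → ℝ) (lam : ℝ)
    (u : E) : Set E :=
  {v | v ∈ Y ∧ IsMinOn (fun v' => lam * ‖v' - u‖ ^ p - f v') Y v}

end

end KernelDRO

/-! ### Concave maximization over perturbations of the atoms. -/

namespace KernelDRO

open MeasureTheory Set Filter Topology

/-! Strong duality follows by closing the cycle perturbation value ≤ primal ≤ dual ≤ perturbation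
value. Moving each atom `y i` to `ζ i` within the budget gives a measure in the ball
(`weightedEmpirical_mem_wassersteinBall`). Weak duality comes from integrating `f v ≤ lam * ‖v - u‖
^ p + g u` against almost optimal couplings (`integral_le_of_mem_wassersteinBall`).

The last inequality rests on concavity. The perturbation problem has a maximizer `ξ`
(`exists_perturbation_maximizer`). For `ε > 0` the unmoved atoms form a Slater point, so a
multiplier exists (`exists_dual_multiplier`), and it attains the dual infimum. For `ε = 0` Slater's
condition fails, but the Lipschitz bound brings the dual objective arbitrarily close to `∑ i, w i *
f (y i)` (`dualValue_le_of_radius_zero`).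

The measure carried by `ξ` is then a worst case in which no atom is split, and complementary
slackness (`mem_innerArgmin_of_dualObjective_le`) gives the argmin conditions for every dual
minimizer. -/

/-- The multiplier is the infimum of the slopes `(M - F ξ) / (T - G ξ)` over strictly feasible
points. A segment from an infeasible point to a strictly feasible one contains a feasible point, so
the slope at the former is at most the slope at the latter. No topology or separation theorem
enters. -/
theorem exists_lagrange_multiplier {V : Type*} [AddCommGroup V] [Module ℝ V] {X : Set V}
    {F G : V → ℝ} (hF : ConcaveOn ℝ X F) (hG : ConvexOn ℝ X G) {T M : ℝ}
    (hM : ∀ ξ ∈ X, G ξ ≤ T → F ξ ≤ M) {ξ₀ : V} (hξ₀ : ξ₀ ∈ X) (hlt : G ξ₀ < T) :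
    ∃ lam : ℝ, 0 ≤ lam ∧ ∀ ξ ∈ X, F ξ - lam * (G ξ - T) ≤ M := by
  set A : Set ℝ := (fun ξ => (M - F ξ) / (T - G ξ)) '' {ξ | ξ ∈ X ∧ G ξ < T} with hA
  have hne : A.Nonempty := ⟨_, ξ₀, ⟨hξ₀, hlt⟩, rfl⟩
  have h0 : ∀ a ∈ A, 0 ≤ a := by
    rintro _ ⟨ξ, ⟨hξ, hξT⟩, rfl⟩
    exact div_nonneg (sub_nonneg.2 (hM ξ hξ hξT.le)) (sub_nonneg.2 hξT.le)
  refine ⟨sInf A, le_csInf hne h0, fun ξ hξ => ?_⟩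
  rcases lt_trichotomy (G ξ) T with h | h | h
  · have hle : sInf A ≤ (M - F ξ) / (T - G ξ) := csInf_le ⟨0, h0⟩ ⟨ξ, ⟨hξ, h⟩, rfl⟩
    rw [le_div_iff₀ (sub_pos.2 h)] at hle
    linarith
  · rw [h, sub_self, mul_zero, sub_zero]
    exact hM ξ hξ h.le
  · have hle : (F ξ - M) / (G ξ - T) ≤ sInf A := by
      refine le_csInf hne ?_
      rintro _ ⟨ζ, ⟨hζ, hζT⟩, rfl⟩
      have ha : 0 < G ξ - T := sub_pos.2 h
      have hb : 0 < T - G ζ := sub_pos.2 hζT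
      have hab : 0 < (G ξ - T) + (T - G ζ) := add_pos ha hb
      -- These weights make `s * G ξ + t * G ζ = T`, so convexity of `G` makes the combination
      -- feasible.
      set s := (T - G ζ) / ((G ξ - T) + (T - G ζ)) with hs
      set t := (G ξ - T) / ((G ξ - T) + (T - G ζ)) with ht
      have hs0 : 0 ≤ s := by positivity
      have ht0 : 0 ≤ t := by positivity
      have hst : s + t = 1 := by rw [hs, ht]; field_simp; ring
      have hFc := hF.2 hξ hζ hs0 ht0 hst
      have hGc := hG.2 hξ hζ hs0 ht0 hst
      have hGT : s • G ξ + t • G ζ = T := by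
        simp only [smul_eq_mul, hs, ht]; field_simp; ring
      have hle := hFc.trans (hM _ (hF.1 hξ hζ hs0 ht0 hst) (hGc.trans hGT.le))
      simp only [smul_eq_mul, hs, ht] at hle
      rw [div_mul_eq_mul_div, div_mul_eq_mul_div, ← add_div, div_le_iff₀ hab] at hle
      rw [div_le_div_iff₀ ha hb]
      linarith
    rw [div_le_iff₀ (sub_pos.2 h)] at hle
    linarith

/-- Where `L * r` exceeds `δ`, multiplying it by `(L * r / δ) ^ (p - 1) ≥ 1` turns it into a
multiple of `r ^ p`. This absorbs a Lipschitz bound into the transport penalty when `ε = 0`. -/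
theorem exists_mul_le_add_mul_rpow {p : ℝ} (hp : 1 ≤ p) {L δ : ℝ} (hL : 0 ≤ L) (hδ : 0 < δ) :
    ∃ lam : ℝ, 0 ≤ lam ∧ ∀ r : ℝ, 0 ≤ r → L * r ≤ lam * r ^ p + δ := by
  rcases hL.eq_or_lt with rfl | hL'
  · exact ⟨0, le_rfl, fun r _ => by simpa using hδ.le⟩
  refine ⟨L * (L / δ) ^ (p - 1), by positivity, fun r hr => ?_⟩
  rcases le_total (L * r) δ with h | h
  · exact h.trans (le_add_of_nonneg_left (by positivity))
  · have hr' : 0 < r := pos_of_mul_pos_right (hδ.trans_le h) hL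
    have h1 : 1 ≤ (L / δ * r) ^ (p - 1) := by
      apply Real.one_le_rpow _ (by linarith)
      rw [div_mul_eq_mul_div, le_div_iff₀ hδ, one_mul]
      exact h
    rw [Real.mul_rpow (by positivity) hr] at h1
    have h2 : r ^ p = r ^ (p - 1) * r := by
      rw [← Real.rpow_add_one hr'.ne', sub_add_cancel]
    calc L * r = L * r * 1 := (mul_one _).symm
      _ ≤ L * r * ((L / δ) ^ (p - 1) * r ^ (p - 1)) := by gcongr
      _ = L * (L / δ) ^ (p - 1) * r ^ p := by rw [h2]; ring
      _ ≤ _ := le_add_of_nonneg_right hδ.le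

theorem isMaxOn_coordinate {V : Type*} {n : ℕ} {Y : Set V} {w : Fin n → ℝ} (hw : ∀ i, 0 ≤ w i)
    {g : Fin n → V → ℝ} {ξ : Fin n → V} (hξ : ∀ i, ξ i ∈ Y)
    (hmax : ∀ ζ : Fin n → V, (∀ i, ζ i ∈ Y) → ∑ i, w i * g i (ζ i) ≤ ∑ i, w i * g i (ξ i))
    {i : Fin n} (hi : w i ≠ 0) {v : V} (hv : v ∈ Y) : g i v ≤ g i (ξ i) := by
  have hwi : 0 < w i := lt_of_le_of_ne (hw i) (Ne.symm hi)
  have h := hmax (Function.update ξ i v) fun j => by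
    by_cases hj : j = i
    · subst hj; simpa using hv
    · simpa [hj] using hξ j
  rw [← Finset.add_sum_erase _ _ (Finset.mem_univ i),
    ← Finset.add_sum_erase _ _ (Finset.mem_univ i)] at h
  have he : ∑ j ∈ Finset.univ.erase i, w j * g j (Function.update ξ i v j)
      = ∑ j ∈ Finset.univ.erase i, w j * g j (ξ j) :=
    Finset.sum_congr rfl fun j hj => by
      rw [Function.update_of_ne (Finset.ne_of_mem_erase hj)]
  rw [he, Function.update_self] at h
  exact le_of_mul_le_mul_left (by linarith) hwi

section FiniteProblem

variable {E : Type*} [NormedAddCommGroup E] [NormedSpace ℝ E] {n : ℕ}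

theorem convexOn_norm_sub_rpow {Y : Set E} (hY : Convex ℝ Y) {p : ℝ} (hp : 1 ≤ p) (u : E) :
    ConvexOn ℝ Y fun v => ‖v - u‖ ^ p := by
  have h : ConvexOn ℝ Y fun v => ‖v - u‖ := by simpa [dist_eq_norm] using convexOn_dist u hY
  refine ⟨hY, fun a ha b hb s t hs ht hst => ?_⟩
  exact (Real.rpow_le_rpow (norm_nonneg _) (h.2 ha hb hs ht hst) (by linarith)).trans
    ((convexOn_rpow hp).2 (norm_nonneg _) (norm_nonneg _) hs ht hst)

theorem convexOn_weighted_sum {Y : Set E} (hY : Convex ℝ Y) {w : Fin n → ℝ} (hw : ∀ i, 0 ≤ w i)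
    {g : Fin n → E → ℝ} (hg : ∀ i, ConvexOn ℝ Y (g i)) :
    ConvexOn ℝ (univ.pi fun _ : Fin n => Y) fun ξ => ∑ i, w i * g i (ξ i) := by
  refine ⟨convex_pi fun _ _ => hY, fun a ha b hb s t hs ht hst => ?_⟩
  simp only [smul_eq_mul, Finset.mul_sum, ← Finset.sum_add_distrib]
  refine Finset.sum_le_sum fun i _ => ?_
  have := mul_le_mul_of_nonneg_left
    ((hg i).2 (ha i (mem_univ i)) (hb i (mem_univ i)) hs ht hst) (hw i)
  simp only [smul_eq_mul, Pi.add_apply, Pi.smul_apply] at this ⊢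
  linarith

theorem concaveOn_weighted_sum {Y : Set E} (hY : Convex ℝ Y) {w : Fin n → ℝ} (hw : ∀ i, 0 ≤ w i)
    {g : Fin n → E → ℝ} (hg : ∀ i, ConcaveOn ℝ Y (g i)) :
    ConcaveOn ℝ (univ.pi fun _ : Fin n => Y) fun ξ => ∑ i, w i * g i (ξ i) := by
  have := (convexOn_weighted_sum hY hw fun i => (hg i).neg).neg
  simpa [Pi.neg_def, Finset.sum_neg_distrib] using this

/-- The budget bounds only coordinates of positive weight. The others affect neither objective nor
cost, so they can be frozen at `y i`, which leaves a compact set. -/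
theorem exists_perturbation_maximizer [FiniteDimensional ℝ E] {Y : Set E} (hYc : IsClosed Y)
    {p : ℝ} (hp : 1 ≤ p) {w : Fin n → ℝ} (hw : ∀ i, 0 ≤ w i) {y : Fin n → E} (hy : ∀ i, y i ∈ Y)
    {f : E → ℝ} (hf : ContinuousOn f Y) {T : ℝ} (hT : 0 ≤ T) :
    ∃ ξ : Fin n → E, (∀ i, ξ i ∈ Y) ∧ ∑ i, w i * ‖ξ i - y i‖ ^ p ≤ T ∧
      ∀ ζ : Fin n → E, (∀ i, ζ i ∈ Y) → ∑ i, w i * ‖ζ i - y i‖ ^ p ≤ T →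
        ∑ i, w i * f (ζ i) ≤ ∑ i, w i * f (ξ i) := by
  have hp0 : 0 < p := by linarith
  have : ProperSpace E := FiniteDimensional.proper_real E
  -- When `w i = 0`, division by zero gives radius `0`, so the ball reduces to `y i`.
  set R : Fin n → ℝ := fun i => (T / w i) ^ (1 / p)
  set C : Set (Fin n → E) := {ξ | ∑ i, w i * ‖ξ i - y i‖ ^ p ≤ T} ∩
    univ.pi fun i => Y ∩ Metric.closedBall (y i) (R i) with hC
  have hcompact : IsCompact C := by
    refine IsCompact.inter_left (isCompact_univ_pi fun i =>
      (isCompact_closedBall (y i) (R i)).inter_left hYc) (isClosed_le ?_ continuous_const)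
    refine continuous_finsetSum _ fun i _ => continuous_const.mul ?_
    exact (((continuous_apply i).sub continuous_const).norm).rpow_const fun _ => Or.inr hp0.le
  have hR : ∀ i, 0 ≤ R i := fun i => Real.rpow_nonneg (div_nonneg hT (hw i)) _
  have hyC : y ∈ C := by
    refine ⟨?_, fun i _ => ⟨hy i, Metric.mem_closedBall_self (hR i)⟩⟩
    simpa [Real.zero_rpow hp0.ne'] using hT
  have hcont : ContinuousOn (fun ξ : Fin n → E => ∑ i, w i * f (ξ i)) C := by
    refine continuousOn_finsetSum _ fun i _ => continuousOn_const.mul ?_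
    exact hf.comp (continuous_apply i).continuousOn fun ξ hξ => (hξ.2 i (mem_univ i)).1
  obtain ⟨ξ, hξ, hmax⟩ := hcompact.exists_isMaxOn ⟨y, hyC⟩ hcont
  refine ⟨ξ, fun i => (hξ.2 i (mem_univ i)).1, hξ.1, fun ζ hζ hζT => ?_⟩
  set ζ' : Fin n → E := fun i => if w i = 0 then y i else ζ i with hζ'
  have hF : ∀ g : Fin n → E → ℝ, ∑ i, w i * g i (ζ' i) = ∑ i, w i * g i (ζ i) := fun g =>
    Finset.sum_congr rfl fun i _ => by
      by_cases h : w i = 0 <;> simp [hζ', h]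
  rw [← hF fun _ => f]
  refine hmax ⟨?_, fun i _ => ?_⟩
  · rw [mem_ofPred_eq, hF fun i v => ‖v - y i‖ ^ p]
    exact hζT
  · by_cases h : w i = 0
    · simpa [hζ', h] using ⟨hy i, hR i⟩
    · have hwi : 0 < w i := lt_of_le_of_ne (hw i) (Ne.symm h)
      have hle : w i * ‖ζ i - y i‖ ^ p ≤ T := le_trans
        (Finset.single_le_sum (f := fun i => w i * ‖ζ i - y i‖ ^ p)
          (fun j _ => mul_nonneg (hw j) (by positivity)) (Finset.mem_univ i)) hζT
      simp only [hζ', h, if_false, mem_inter_iff, hζ i, true_and, mem_closedBall_iff_norm]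
      simp only [R, one_div]
      rw [Real.le_rpow_inv_iff_of_pos (norm_nonneg _) (div_nonneg hT hwi.le) hp0, le_div_iff₀ hwi]
      linarith

/-- For a positive budget, the finite-dimensional problem has a Lagrange multiplier. -/
theorem exists_dual_multiplier {Y : Set E} (hY : Convex ℝ Y)
    {p : ℝ} (hp : 1 ≤ p) {w : Fin n → ℝ} (hw : ∀ i, 0 ≤ w i) {y : Fin n → E} (hy : ∀ i, y i ∈ Y)
    {f : E → ℝ} (hf : ConcaveOn ℝ Y f) {T : ℝ} (hT : 0 < T) {ξ : Fin n → E}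
    (hξ : ∀ i, ξ i ∈ Y) (hξT : ∑ i, w i * ‖ξ i - y i‖ ^ p ≤ T)
    (hmax : ∀ ζ : Fin n → E, (∀ i, ζ i ∈ Y) → ∑ i, w i * ‖ζ i - y i‖ ^ p ≤ T →
        ∑ i, w i * f (ζ i) ≤ ∑ i, w i * f (ξ i)) :
    ∃ (lam : ℝ) (b : Fin n → ℝ), 0 ≤ lam ∧
      (∀ i, w i ≠ 0 → ∀ v ∈ Y, f v - lam * ‖v - y i‖ ^ p ≤ b i) ∧
      lam * T + ∑ i, w i * b i ≤ ∑ i, w i * f (ξ i) := by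
  have hp0 : p ≠ 0 := by linarith
  -- The Slater point is `y` itself, with cost `0 < T`.
  obtain ⟨lam, hlam, hle⟩ := exists_lagrange_multiplier
    (concaveOn_weighted_sum hY hw fun _ => hf)
    (convexOn_weighted_sum hY hw fun i => convexOn_norm_sub_rpow hY hp (y i))
    (T := T) (M := ∑ i, w i * f (ξ i))
    (fun ζ hζ => hmax ζ fun i => hζ i (mem_univ i)) (ξ₀ := y) (fun i _ => hy i)
    (by simpa [Real.zero_rpow hp0] using hT)
  have hsum : ∀ ζ : Fin n → E, ∑ i, w i * (f (ζ i) - lam * ‖ζ i - y i‖ ^ p)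
      = ∑ i, w i * f (ζ i) - lam * ∑ i, w i * ‖ζ i - y i‖ ^ p := fun ζ => by
    rw [Finset.mul_sum, ← Finset.sum_sub_distrib]
    exact Finset.sum_congr rfl fun i _ => by ring
  have hslack : lam * ∑ i, w i * ‖ξ i - y i‖ ^ p ≤ lam * T := mul_le_mul_of_nonneg_left hξT hlam
  -- The multiplier bound and feasibility make `ξ` a maximizer of the Lagrangian, which is
  -- separable, so each coordinate of nonzero weight is maximal by itself.
  refine ⟨lam, fun i => f (ξ i) - lam * ‖ξ i - y i‖ ^ p, hlam, fun i hi v hv => ?_, ?_⟩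
  · refine isMaxOn_coordinate (g := fun i v => f v - lam * ‖v - y i‖ ^ p) hw hξ
      (fun ζ hζ => ?_) hi hv
    have := hle ζ fun i _ => hζ i
    simp only [hsum]
    linarith
  · have := hle ξ fun i _ => hξ i
    rw [hsum]
    linarith

end FiniteProblem

end KernelDRO

/-! ### Weighted empirical measures, couplings and weak duality. -/

namespace KernelDRO

open MeasureTheory Set Filter Topology

section WeightedEmpirical

variable {E : Type*} [MeasurableSpace E] {n : ℕ} {w : Fin n → ℝ}

theorem isProbabilityMeasure_weightedEmpirical (hw : ∀ i, 0 ≤ w i) (hw1 : ∑ i, w i = 1)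
    (y : Fin n → E) : IsProbabilityMeasure (weightedEmpirical w y) := by
  constructor
  simp [weightedEmpirical, ← ENNReal.ofReal_sum_of_nonneg fun i _ => hw i, hw1]

theorem map_weightedEmpirical {F : Type*} [MeasurableSpace F] (w : Fin n → ℝ) (y : Fin n → E)
    {g : E → F} (hg : Measurable g) :
    (weightedEmpirical w y).map g = weightedEmpirical w (fun i => g (y i)) := by
  simp [weightedEmpirical, Measure.map_finset_sum hg.aemeasurable, Measure.map_smul,
    Measure.map_dirac' hg]

variable [MeasurableSingletonClass E]

theorem lintegral_weightedEmpirical (w : Fin n → ℝ) (y : Fin n → E) (g : E → ℝ≥0∞) :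
    ∫⁻ u, g u ∂(weightedEmpirical w y) = ∑ i, ENNReal.ofReal (w i) * g (y i) := by
  simp [weightedEmpirical, lintegral_finsetSum_measure, lintegral_smul_measure]

theorem integrable_weightedEmpirical (w : Fin n → ℝ) (y : Fin n → E) (g : E → ℝ) :
    Integrable g (weightedEmpirical w y) := by
  rw [weightedEmpirical, integrable_finsetSum_measure]
  exact fun i _ => (integrable_dirac (by simp)).smul_measure ENNReal.ofReal_ne_top

theorem integral_weightedEmpirical (hw : ∀ i, 0 ≤ w i) (y : Fin n → E) (g : E → ℝ) :
    ∫ u, g u ∂(weightedEmpirical w y) = ∑ i, w i * g (y i) := by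
  rw [weightedEmpirical, integral_finsetSum_measure]
  · simp [integral_smul_measure, hw]
  · exact fun i _ => (integrable_dirac (by simp)).smul_measure ENNReal.ofReal_ne_top

theorem weightedEmpirical_eq_zero (w : Fin n → ℝ) (y : Fin n → E) {s : Set E}
    (hs : ∀ i, w i ≠ 0 → y i ∉ s) : weightedEmpirical w y s = 0 := by
  simp only [weightedEmpirical, Measure.coe_finsetSum, Finset.sum_apply, Measure.smul_apply,
    Measure.dirac_apply, smul_eq_mul]
  refine Finset.sum_eq_zero fun i _ => ?_
  by_cases h : w i = 0
  · simp [h]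
  · simp [hs i h]

end WeightedEmpirical

section Coupling

variable {E : Type*} [NormedAddCommGroup E] [NormedSpace ℝ E] [FiniteDimensional ℝ E]
  [MeasurableSpace E] [BorelSpace E] {n : ℕ}

theorem integrable_cost {p : ℝ} (hp : 0 ≤ p) {ξ : Measure (E × E)}
    (hξ : ∫⁻ q, ‖q.1 - q.2‖ₑ ^ p ∂ξ ≠ ⊤) :
    Integrable (fun q : E × E => ‖q.2 - q.1‖ ^ p) ξ ∧
      ∫ q, ‖q.2 - q.1‖ ^ p ∂ξ = (∫⁻ q, ‖q.1 - q.2‖ₑ ^ p ∂ξ).toReal := by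
  have : SecondCountableTopology E := by
    have : ProperSpace E := FiniteDimensional.proper_real E
    infer_instance
  have hcont : Continuous fun q : E × E => ‖q.2 - q.1‖ ^ p :=
    (continuous_snd.sub continuous_fst).norm.rpow_const fun _ => Or.inr hp
  have hm : AEStronglyMeasurable (fun q : E × E => ‖q.2 - q.1‖ ^ p) ξ :=
    hcont.aestronglyMeasurable
  have hnn : ∀ q : E × E, 0 ≤ ‖q.2 - q.1‖ ^ p := fun q => by positivity
  have he : ∀ q : E × E, ENNReal.ofReal (‖q.2 - q.1‖ ^ p) = ‖q.1 - q.2‖ₑ ^ p := fun q => by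
    rw [← ENNReal.ofReal_rpow_of_nonneg (norm_nonneg _) hp, norm_sub_rev, ofReal_norm]
  constructor
  · refine ⟨hm, ?_⟩
    rw [hasFiniteIntegral_iff_ofReal (Eventually.of_forall hnn)]
    simpa only [he] using hξ.lt_top
  · rw [integral_eq_lintegral_of_nonneg_ae (Eventually.of_forall hnn) hm]
    simp only [he]

/-- The strict inequality avoids the existence of optimal couplings; users take `r > ε`. -/
theorem exists_coupling_of_wassersteinDist_lt {p : ℝ} (hp : 0 < p) {μ ν : Measure E} {r : ℝ}
    (hr : 0 ≤ r) (h : wassersteinDist p μ ν < ENNReal.ofReal r) :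
    ∃ ξ : Measure (E × E), ξ.map Prod.fst = μ ∧ ξ.map Prod.snd = ν ∧
      Integrable (fun q : E × E => ‖q.2 - q.1‖ ^ p) ξ ∧ ∫ q, ‖q.2 - q.1‖ ^ p ∂ξ ≤ r ^ p := by
  simp only [wassersteinDist, iInf_lt_iff] at h
  obtain ⟨ξ, ⟨h1, h2⟩, hlt⟩ := h
  rw [one_div, ENNReal.rpow_inv_lt_iff hp, ENNReal.ofReal_rpow_of_nonneg hr hp.le] at hlt
  obtain ⟨hi, he⟩ := integrable_cost hp.le hlt.ne_top
  refine ⟨ξ, h1, h2, hi, ?_⟩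
  rw [he]
  exact ENNReal.toReal_le_of_le_ofReal (by positivity) hlt.le

variable {Y : Set E} {p : ℝ} {w : Fin n → ℝ} {y : Fin n → E} {f : E → ℝ} {L : ℝ≥0}
  {μ : Measure E} {ξ : Measure (E × E)}

/-- Nothing is known about `f` off `Y`, but `μ` does not charge that set. -/
theorem aestronglyMeasurable_of_lipschitzOnWith (hYc : IsClosed Y) (hf : LipschitzOnWith L f Y)
    (hμ : μ Yᶜ = 0) : AEStronglyMeasurable f μ := by
  have : SecondCountableTopology E := by
    have : ProperSpace E := FiniteDimensional.proper_real E
    infer_instance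
  have := hf.continuousOn.aestronglyMeasurable (μ := μ) hYc.measurableSet
  rwa [Measure.restrict_eq_self_of_ae_mem (mem_ae_iff.2 hμ)] at this

/-- The Lipschitz bound through `y₀` leaves the transport cost, which is integrable, and a function
of the first coordinate, integrable because that marginal is finitely supported. No moment of `μ` is
assumed. -/
theorem integrable_snd_of_coupling (hYc : IsClosed Y) (hp : 1 ≤ p)
    (hf : LipschitzOnWith L f Y) {y₀ : E} (hy₀ : y₀ ∈ Y) (hμ : μ Yᶜ = 0)
    (h1 : ξ.map Prod.fst = weightedEmpirical w y) (h2 : ξ.map Prod.snd = μ)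
    (hξ : Integrable (fun q : E × E => ‖q.2 - q.1‖ ^ p) ξ) :
    Integrable (fun q : E × E => f q.2) ξ := by
  subst h2
  have hfst : ∀ g : E → ℝ, Integrable (fun q : E × E => g q.1) ξ := fun g =>
    (h1 ▸ integrable_weightedEmpirical w y g : Integrable g (ξ.map Prod.fst)).comp_measurable
      measurable_fst
  have hbound : Integrable
      (fun q : E × E => L * ‖q.2 - q.1‖ ^ p + (|f y₀| + L * (1 + ‖q.1 - y₀‖))) ξ :=
    (hξ.const_mul _).add (hfst fun u => |f y₀| + L * (1 + ‖u - y₀‖))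
  refine hbound.mono' ((aestronglyMeasurable_of_lipschitzOnWith hYc hf hμ).comp_measurable
    measurable_snd) ?_
  have hY : ∀ᵐ q ∂ξ, q.2 ∈ Y := ae_of_ae_map measurable_snd.aemeasurable (mem_ae_iff.2 hμ)
  filter_upwards [hY] with q hq
  have h3 : |f q.2 - f y₀| ≤ L * ‖q.2 - y₀‖ := by
    simpa [dist_eq_norm] using hf.dist_le_mul q.2 hq y₀ hy₀
  have h4 : ‖q.2 - y₀‖ ≤ ‖q.2 - q.1‖ + ‖q.1 - y₀‖ := norm_sub_le_norm_sub_add_norm_sub _ _ _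
  have h5 : ‖q.2 - q.1‖ ≤ 1 + ‖q.2 - q.1‖ ^ p := by
    rcases le_total ‖q.2 - q.1‖ 1 with h | h
    · exact h.trans (le_add_of_nonneg_right (by positivity))
    · exact (Real.self_le_rpow_of_one_le h hp).trans (le_add_of_nonneg_left zero_le_one)
  have h6 : |f q.2| ≤ |f y₀| + |f q.2 - f y₀| := by
    simpa using abs_add_le (f y₀) (f q.2 - f y₀)
  have h7 : (L : ℝ) * ‖q.2 - y₀‖ ≤ L * (1 + ‖q.2 - q.1‖ ^ p + ‖q.1 - y₀‖) :=
    mul_le_mul_of_nonneg_left (by linarith) L.2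
  rw [Real.norm_eq_abs]
  linarith

/-- The first marginal lives on the atoms of nonzero weight, so the pointwise bound `hg` holds
almost everywhere under the coupling and can be integrated. -/
theorem integral_le_of_coupling (hYc : IsClosed Y) (hp : 1 ≤ p)
    (hf : LipschitzOnWith L f Y) {y₀ : E} (hy₀ : y₀ ∈ Y) (hw : ∀ i, 0 ≤ w i) (hμ : μ Yᶜ = 0)
    (h1 : ξ.map Prod.fst = weightedEmpirical w y) (h2 : ξ.map Prod.snd = μ)
    (hξ : Integrable (fun q : E × E => ‖q.2 - q.1‖ ^ p) ξ) {lam : ℝ} {g : E → ℝ}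
    (hg : ∀ i, w i ≠ 0 → ∀ v ∈ Y, f v - lam * ‖v - y i‖ ^ p ≤ g (y i)) :
    ∫ v, f v ∂μ ≤ lam * ∫ q, ‖q.2 - q.1‖ ^ p ∂ξ + ∑ i, w i * g (y i) := by
  have hfi := integrable_snd_of_coupling hYc hp hf hy₀ hμ h1 h2 hξ
  subst h2
  have hgi : Integrable g (ξ.map Prod.fst) := h1 ▸ integrable_weightedEmpirical w y g
  have hgc : Integrable (fun q : E × E => g q.1) ξ := hgi.comp_measurable measurable_fst
  rw [integral_map measurable_snd.aemeasurable
    (aestronglyMeasurable_of_lipschitzOnWith hYc hf hμ), ← integral_weightedEmpirical hw, ← h1,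
    integral_map measurable_fst.aemeasurable hgi.aestronglyMeasurable, ← integral_const_mul,
    ← integral_add (hξ.const_mul lam) hgc]
  refine integral_mono_ae hfi ((hξ.const_mul lam).add hgc) ?_
  have hY : ∀ᵐ q ∂ξ, q.2 ∈ Y := ae_of_ae_map measurable_snd.aemeasurable (mem_ae_iff.2 hμ)
  have hX : ∀ᵐ q ∂ξ, q.1 ∈ {u | ∃ i, w i ≠ 0 ∧ y i = u} := by
    refine ae_of_ae_map measurable_fst.aemeasurable ?_
    rw [h1]
    exact mem_ae_iff.2 (weightedEmpirical_eq_zero w y fun i hi hn => hn ⟨i, hi, rfl⟩)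
  filter_upwards [hY, hX] with q hq hq'
  obtain ⟨i, hi, hiq⟩ := hq'
  have := hg i hi q.2 hq
  rw [hiq] at this
  linarith

variable {ε : ℝ}

theorem integrable_of_mem_wassersteinBall (hYc : IsClosed Y) (hp : 1 ≤ p)
    (hf : LipschitzOnWith L f Y) {y₀ : E} (hy₀ : y₀ ∈ Y) (hε : 0 ≤ ε)
    (hμ : μ ∈ wassersteinBall Y p ε (weightedEmpirical w y)) : Integrable f μ := by
  obtain ⟨-, hμY, hdist⟩ := hμ
  obtain ⟨ξ, h1, h2, hi, -⟩ := exists_coupling_of_wassersteinDist_lt (r := ε + 1) (by linarith)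
    (by linarith) (hdist.trans_lt ((ENNReal.ofReal_lt_ofReal_iff (by linarith)).2 (by linarith)))
  have := integrable_snd_of_coupling hYc hp hf hy₀ hμY h1 h2 hi
  subst h2
  exact (integrable_map_measure (aestronglyMeasurable_of_lipschitzOnWith hYc hf hμY)
    measurable_snd.aemeasurable).2 this

/-- Weak duality. -/
theorem integral_le_of_mem_wassersteinBall (hYc : IsClosed Y) (hp : 1 ≤ p)
    (hf : LipschitzOnWith L f Y) {y₀ : E} (hy₀ : y₀ ∈ Y) (hw : ∀ i, 0 ≤ w i) (hε : 0 ≤ ε)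
    (hμ : μ ∈ wassersteinBall Y p ε (weightedEmpirical w y)) {lam : ℝ} (hlam : 0 ≤ lam)
    {g : E → ℝ} (hg : ∀ i, w i ≠ 0 → ∀ v ∈ Y, f v - lam * ‖v - y i‖ ^ p ≤ g (y i)) :
    ∫ v, f v ∂μ ≤ lam * ε ^ p + ∑ i, w i * g (y i) := by
  obtain ⟨-, hμY, hdist⟩ := hμ
  have hcont : Continuous fun r : ℝ => lam * r ^ p + ∑ i, w i * g (y i) :=
    (continuous_const.mul (Real.continuous_rpow_const (by linarith))).add continuous_const
  -- The bound is proved for every `r > ε`, and `r` then decreases to `ε`.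
  refine ge_of_tendsto (hcont.continuousWithinAt (s := Ioi ε)).tendsto ?_
  filter_upwards [self_mem_nhdsWithin] with r hr
  have hr' : ε < r := hr
  obtain ⟨ξ, h1, h2, hi, hle⟩ := exists_coupling_of_wassersteinDist_lt (r := r) (by linarith)
    (by linarith) (hdist.trans_lt ((ENNReal.ofReal_lt_ofReal_iff (by linarith)).2 hr'))
  exact (integral_le_of_coupling hYc hp hf hy₀ hw hμY h1 h2 hi hg).trans (by gcongr)

theorem weightedEmpirical_mem_wassersteinBall (hp : 0 < p) (hw : ∀ i, 0 ≤ w i)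
    (hw1 : ∑ i, w i = 1) (hε : 0 ≤ ε) {ζ : Fin n → E} (hζ : ∀ i, ζ i ∈ Y)
    (hcost : ∑ i, w i * ‖ζ i - y i‖ ^ p ≤ ε ^ p) :
    weightedEmpirical w ζ ∈ wassersteinBall Y p ε (weightedEmpirical w y) := by
  refine ⟨isProbabilityMeasure_weightedEmpirical hw hw1 ζ,
    weightedEmpirical_eq_zero w ζ fun i _ hi => hi (hζ i), ?_⟩
  -- The coupling sends the mass of `y i` to `ζ i`.
  refine (iInf₂_le (weightedEmpirical w fun i => (y i, ζ i))
    ⟨map_weightedEmpirical w _ measurable_fst, map_weightedEmpirical w _ measurable_snd⟩).trans ?_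
  rw [one_div, ENNReal.rpow_inv_le_iff hp, ENNReal.ofReal_rpow_of_nonneg hε hp.le,
    lintegral_weightedEmpirical]
  refine le_trans (le_of_eq ?_) (ENNReal.ofReal_le_ofReal hcost)
  rw [ENNReal.ofReal_sum_of_nonneg fun i _ => mul_nonneg (hw i) (by positivity)]
  refine Finset.sum_congr rfl fun i _ => ?_
  rw [ENNReal.ofReal_mul (hw i), ← ENNReal.ofReal_rpow_of_nonneg (norm_nonneg _) hp.le,
    norm_sub_rev, ofReal_norm]

end Coupling

end KernelDRO

/-! ### The dual objective in the extended reals, and strong duality. -/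

namespace KernelDRO

open MeasureTheory Set Filter Topology

theorem coe_finsetSum_ereal {ι : Type*} (s : Finset ι) (a : ι → ℝ) :
    ((∑ i ∈ s, a i : ℝ) : EReal) = ∑ i ∈ s, (a i : EReal) := by
  classical
  induction s using Finset.induction_on with
  | empty => simp
  | insert i s hi ih => rw [Finset.sum_insert hi, Finset.sum_insert hi, EReal.coe_add, ih]

theorem sum_ne_bot_ereal {ι : Type*} (s : Finset ι) {a : ι → EReal} (ha : ∀ i ∈ s, a i ≠ ⊥) :
    ∑ i ∈ s, a i ≠ ⊥ := by
  classical
  induction s using Finset.induction_on with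
  | empty => simp
  | insert i s hi ih =>
    rw [Finset.sum_insert hi]
    exact EReal.add_ne_bot_iff.2 ⟨ha i (Finset.mem_insert_self i s),
      ih fun j hj => ha j (Finset.mem_insert_of_mem hj)⟩

section WeightedSum

variable {n : ℕ} {w : Fin n → ℝ} {S : Fin n → EReal}

/-- Zero weights erase infinite values because `0 * ⊤ = 0`. -/
theorem weighted_sum_eq_coe {b : Fin n → ℝ} (hb : ∀ i, w i ≠ 0 → S i = b i) :
    ∑ i, (w i : EReal) * S i = ((∑ i, w i * b i : ℝ) : EReal) := by
  rw [coe_finsetSum_ereal]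
  refine Finset.sum_congr rfl fun i _ => ?_
  by_cases h : w i = 0
  · simp [h]
  · rw [hb i h, EReal.coe_mul]

theorem weighted_sum_eq_top (hw : ∀ i, 0 ≤ w i) (hS : ∀ i, S i ≠ ⊥) {i : Fin n} (hi : w i ≠ 0)
    (htop : S i = ⊤) : ∑ i, (w i : EReal) * S i = ⊤ := by
  have hpos : ∀ j, w j ≠ 0 → 0 < w j := fun j hj => lt_of_le_of_ne (hw j) (Ne.symm hj)
  rw [← Finset.add_sum_erase _ _ (Finset.mem_univ i), htop, EReal.coe_mul_top_of_pos (hpos i hi)]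
  refine EReal.top_add_of_ne_bot (sum_ne_bot_ereal _ fun j _ => ?_)
  by_cases h : w j = 0
  · simp [h]
  · induction hj : S j with
    | bot => exact absurd hj (hS j)
    | top => simp [EReal.coe_mul_top_of_pos (hpos j h)]
    | coe r => rw [← EReal.coe_mul]; exact EReal.coe_ne_bot _

theorem exists_coe_or_exists_top (hS : ∀ i, S i ≠ ⊥) :
    (∃ i, w i ≠ 0 ∧ S i = ⊤) ∨ ∃ b : Fin n → ℝ, ∀ i, w i ≠ 0 → S i = b i := by
  by_cases h : ∃ i, w i ≠ 0 ∧ S i = ⊤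
  · exact Or.inl h
  · push Not at h
    exact Or.inr ⟨fun i => (S i).toReal, fun i hi => (EReal.coe_toReal (h i hi) (hS i)).symm⟩

/-- If some `S (y i)` of nonzero weight is `⊤`, the subtracted integral is `⊤` and both sides are
`⊥`. Otherwise all relevant values are real and recombine from their positive and negative parts. -/
theorem extExpectation_weightedEmpirical_neg {E : Type*} [MeasurableSpace E]
    [MeasurableSingletonClass E] (hw : ∀ i, 0 ≤ w i) (y : Fin n → E) {S : E → EReal}
    (hS : ∀ u, S u ≠ ⊥) :
    extExpectation (weightedEmpirical w y) (fun u => -S u) =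
      -∑ i, (w i : EReal) * S (y i) := by
  simp only [extExpectation, neg_neg, lintegral_weightedEmpirical]
  rcases exists_coe_or_exists_top (w := w) (S := fun i => S (y i)) fun i => hS (y i) with
    ⟨i, hi, htop⟩ | ⟨b, hb⟩
  · have hwi : ENNReal.ofReal (w i) ≠ 0 := by
      simpa using lt_of_le_of_ne (hw i) (Ne.symm hi)
    have h1 : ∑ i, ENNReal.ofReal (w i) * (S (y i)).toENNReal = ⊤ :=
      ENNReal.sum_eq_top.2 ⟨i, Finset.mem_univ i, by simp [htop, ENNReal.mul_top hwi]⟩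
    rw [h1, weighted_sum_eq_top hw (fun i => hS (y i)) hi htop, EReal.coe_ennreal_top,
      EReal.sub_top, EReal.neg_top]
  · have h1 : ∀ s : ℝ, ∑ i, ENNReal.ofReal (w i) * ((s : EReal) * S (y i)).toENNReal
        = ENNReal.ofReal (∑ i, w i * max (s * b i) 0) := fun s => by
      rw [ENNReal.ofReal_sum_of_nonneg fun i _ => mul_nonneg (hw i) (le_max_right _ _)]
      refine Finset.sum_congr rfl fun i _ => ?_
      by_cases h : w i = 0
      · simp [h]
      · rw [hb i h, ← EReal.coe_mul, EReal.toENNReal_of_ne_top (EReal.coe_ne_top _),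
          EReal.toReal_coe, ENNReal.ofReal_mul (hw i)]
        congr 1
        rcases le_total (s * b i) 0 with h0 | h0
        · simp [h0, ENNReal.ofReal_of_nonpos h0]
        · simp [h0]
    have hpos : ∑ i, ENNReal.ofReal (w i) * (S (y i)).toENNReal
        = ENNReal.ofReal (∑ i, w i * max (b i) 0) := by simpa using h1 1
    have hneg : ∑ i, ENNReal.ofReal (w i) * (-S (y i)).toENNReal
        = ENNReal.ofReal (∑ i, w i * max (-b i) 0) := by simpa [EReal.neg_mul] using h1 (-1)
    have hnn : ∀ a : Fin n → ℝ, 0 ≤ ∑ i, w i * max (a i) 0 := fun a =>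
      Finset.sum_nonneg fun i _ => mul_nonneg (hw i) (le_max_right _ _)
    rw [hpos, hneg, weighted_sum_eq_coe hb, EReal.coe_ennreal_ofReal, EReal.coe_ennreal_ofReal,
      max_eq_left (hnn b), max_eq_left (hnn fun i => -b i), ← EReal.coe_sub, ← EReal.coe_neg,
      EReal.coe_eq_coe_iff, ← Finset.sum_sub_distrib, ← Finset.sum_neg_distrib]
    refine Finset.sum_congr rfl fun i _ => ?_
    rcases le_total (b i) 0 with h | h
    · rw [max_eq_right h, max_eq_left (neg_nonneg.2 h)]; ring
    · rw [max_eq_left h, max_eq_right (neg_nonpos.2 h)]; ring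

end WeightedSum

/-- The supremum of the penalized reward `v ↦ f v - λ ‖v - u‖ ^ p` over `Y`. -/
noncomputable def penalizedSup {E : Type*} [NormedAddCommGroup E] (Y : Set E) (p : ℝ) (f : E → ℝ)
    (lam : ℝ) (u : E) : EReal :=
  ⨆ v ∈ Y, ((f v - lam * ‖v - u‖ ^ p : ℝ) : EReal)

theorem le_penalizedSup {E : Type*} [NormedAddCommGroup E] {Y : Set E} (p : ℝ) (f : E → ℝ)
    (lam : ℝ) (u : E) {v : E} (hv : v ∈ Y) :
    ((f v - lam * ‖v - u‖ ^ p : ℝ) : EReal) ≤ penalizedSup Y p f lam u :=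
  le_iSup₂ (f := fun v (_ : v ∈ Y) => ((f v - lam * ‖v - u‖ ^ p : ℝ) : EReal)) v hv

theorem penalizedSup_ne_bot {E : Type*} [NormedAddCommGroup E] {Y : Set E} (hY : Y.Nonempty)
    (p : ℝ) (f : E → ℝ) (lam : ℝ) (u : E) : penalizedSup Y p f lam u ≠ ⊥ := by
  obtain ⟨v, hv⟩ := hY
  intro h
  have := le_penalizedSup p f lam u hv
  rw [h, le_bot_iff] at this
  exact EReal.coe_ne_bot _ this

section Dual

variable {E : Type*} [NormedAddCommGroup E] [MeasurableSpace E] [MeasurableSingletonClass E]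
  {n : ℕ} {Y : Set E} {p ε : ℝ} {w : Fin n → ℝ} {y : Fin n → E} {f : E → ℝ} {lam : ℝ}

theorem dualObjective_eq (hY : Y.Nonempty) (p ε : ℝ) (hw : ∀ i, 0 ≤ w i) (y : Fin n → E)
    (f : E → ℝ) (lam : ℝ) :
    dualObjective Y p ε (weightedEmpirical w y) f lam =
      ((lam * ε ^ p : ℝ) : EReal) + ∑ i, (w i : EReal) * penalizedSup Y p f lam (y i) := by
  have hinf : (fun u => ⨅ v ∈ Y, ((lam * ‖u - v‖ ^ p - f v : ℝ) : EReal)) =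
      fun u => -penalizedSup Y p f lam u := by
    funext u
    have hneg : ∀ v, ((lam * ‖u - v‖ ^ p - f v : ℝ) : EReal) =
        -((f v - lam * ‖v - u‖ ^ p : ℝ) : EReal) := fun v => by
      rw [← EReal.coe_neg, neg_sub, norm_sub_rev]
    refine le_antisymm (EReal.le_neg_of_le_neg (iSup₂_le fun v hv => ?_)) (le_iInf₂ fun v hv => ?_)
    · rw [EReal.le_neg, ← hneg]
      exact iInf₂_le v hv
    · rw [hneg, EReal.neg_le_neg_iff]
      exact le_penalizedSup p f lam u hv
  rw [dualObjective, hinf,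
    extExpectation_weightedEmpirical_neg hw y (penalizedSup_ne_bot hY p f lam), sub_eq_add_neg,
    neg_neg]

theorem dualObjective_le (hY : Y.Nonempty) (hw : ∀ i, 0 ≤ w i) {b : Fin n → ℝ}
    (hb : ∀ i, w i ≠ 0 → ∀ v ∈ Y, f v - lam * ‖v - y i‖ ^ p ≤ b i) :
    dualObjective Y p ε (weightedEmpirical w y) f lam ≤
      ((lam * ε ^ p + ∑ i, w i * b i : ℝ) : EReal) := by
  rw [dualObjective_eq hY p ε hw, EReal.coe_add]
  refine add_le_add le_rfl ?_
  rw [coe_finsetSum_ereal]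
  refine Finset.sum_le_sum fun i _ => ?_
  by_cases h : w i = 0
  · simp [h]
  · rw [EReal.coe_mul]
    exact mul_le_mul_of_nonneg_left
      (iSup₂_le fun v hv => EReal.coe_le_coe_iff.2 (hb i h v hv)) (EReal.coe_nonneg.2 (hw i))

/-- The bound `g` depends on the location rather than on the index, so that it can be integrated
against the first marginal of a coupling. -/
theorem dualObjective_cases (hY : Y.Nonempty) (p ε : ℝ) (hw : ∀ i, 0 ≤ w i) (y : Fin n → E)
    (f : E → ℝ) (lam : ℝ) :
    dualObjective Y p ε (weightedEmpirical w y) f lam = ⊤ ∨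
      ∃ g : E → ℝ, (∀ i, w i ≠ 0 → ∀ v ∈ Y, f v - lam * ‖v - y i‖ ^ p ≤ g (y i)) ∧
        dualObjective Y p ε (weightedEmpirical w y) f lam =
          ((lam * ε ^ p + ∑ i, w i * g (y i) : ℝ) : EReal) := by
  rw [dualObjective_eq hY p ε hw]
  have hS : ∀ i, penalizedSup Y p f lam (y i) ≠ ⊥ := fun i => penalizedSup_ne_bot hY p f lam _
  rcases exists_coe_or_exists_top (w := w) hS with ⟨i, hi, htop⟩ | ⟨b, hb⟩
  · exact Or.inl (by rw [weighted_sum_eq_top hw hS hi htop, EReal.coe_add_top])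
  · have hg : ∀ i, w i ≠ 0 → penalizedSup Y p f lam (y i) =
        ((penalizedSup Y p f lam (y i)).toReal : EReal) := fun i hi => by
      rw [hb i hi, EReal.toReal_coe]
    refine Or.inr ⟨fun u => (penalizedSup Y p f lam u).toReal, fun i hi v hv => ?_, ?_⟩
    · rw [← EReal.coe_le_coe_iff, ← hg i hi]
      exact le_penalizedSup p f lam (y i) hv
    · rw [weighted_sum_eq_coe hg, EReal.coe_add]

/-- Complementary slackness. -/
theorem mem_innerArgmin_of_dualObjective_le (hw : ∀ i, 0 ≤ w i) (hlam : 0 ≤ lam)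
    {ξ : Fin n → E} (hξ : ∀ i, ξ i ∈ Y) (hcost : ∑ i, w i * ‖ξ i - y i‖ ^ p ≤ ε ^ p)
    (hle : dualObjective Y p ε (weightedEmpirical w y) f lam ≤
      ((∑ i, w i * f (ξ i) : ℝ) : EReal)) {i : Fin n} (hi : w i ≠ 0) :
    ξ i ∈ innerArgmin Y p f lam (y i) := by
  rcases dualObjective_cases ⟨ξ i, hξ i⟩ p ε hw y f lam with h | ⟨g, hg, h⟩
  · rw [h, top_le_iff] at hle
    exact absurd hle (EReal.coe_ne_top _)
  rw [h, EReal.coe_le_coe_iff] at hle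
  have hterm : ∀ j ∈ Finset.univ, w j * (f (ξ j) - lam * ‖ξ j - y j‖ ^ p) ≤ w j * g (y j) := by
    intro j _
    by_cases hj : w j = 0
    · simp [hj]
    · exact mul_le_mul_of_nonneg_left (hg j hj _ (hξ j)) (hw j)
  have hsum : ∑ j, w j * (f (ξ j) - lam * ‖ξ j - y j‖ ^ p) =
      ∑ j, w j * f (ξ j) - lam * ∑ j, w j * ‖ξ j - y j‖ ^ p := by
    rw [Finset.mul_sum, ← Finset.sum_sub_distrib]
    exact Finset.sum_congr rfl fun j _ => by ring
  have hslack := mul_le_mul_of_nonneg_left hcost hlam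
  -- The duality gap is closed, so the termwise inequalities have equal sums and each is an
  -- equality.
  have heq := (Finset.sum_eq_sum_iff_of_le hterm).1
    (le_antisymm (Finset.sum_le_sum hterm) (by linarith)) i (Finset.mem_univ i)
  have heq' := mul_left_cancel₀ hi heq
  refine ⟨hξ i, fun v hv => ?_⟩
  have := hg i hi v hv
  simp only [mem_ofPred_eq]
  linarith

theorem dualValue_le_of_radius_zero (hp : 1 ≤ p) (hw : ∀ i, 0 ≤ w i) (hw1 : ∑ i, w i = 1)
    (hY : Y.Nonempty) (hy : ∀ i, y i ∈ Y) {L : ℝ≥0} (hf : LipschitzOnWith L f Y) :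
    dualValue Y p 0 (weightedEmpirical w y) f ≤ ((∑ i, w i * f (y i) : ℝ) : EReal) := by
  refine EReal.le_of_forall_lt_iff_le.1 fun M hM => ?_
  rw [EReal.coe_lt_coe_iff] at hM
  -- With the gap `M - ∑ i, w i * f (y i)` as `δ`, this `lam` keeps each penalized reward within `δ`
  -- of `f (y i)`; the term `lam * 0 ^ p` costs nothing.
  obtain ⟨lam, hlam, hle⟩ := exists_mul_le_add_mul_rpow hp L.2 (sub_pos.2 hM)
  refine (iInf₂_le lam hlam).trans ((dualObjective_le hY hw
    (b := fun i => f (y i) + (M - ∑ i, w i * f (y i))) fun i _ v hv => ?_).trans ?_)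
  · have h1 : |f v - f (y i)| ≤ L * ‖v - y i‖ := by
      simpa [dist_eq_norm] using hf.dist_le_mul v hv (y i) (hy i)
    have h2 : f v - f (y i) ≤ L * ‖v - y i‖ := (le_abs_self _).trans h1
    have h3 : (L : ℝ) * ‖v - y i‖ ≤ _ := hle ‖v - y i‖ (norm_nonneg _)
    linarith
  · rw [EReal.coe_le_coe_iff, Real.zero_rpow (by linarith)]
    simp [mul_add, Finset.sum_add_distrib, ← Finset.sum_mul, hw1]

end Dual

/-- Strong duality: an optimal perturbation of the atoms attains the dual value. -/
theorem exists_optimal_perturbation {E : Type*} [NormedAddCommGroup E] [NormedSpace ℝ E]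
    [FiniteDimensional ℝ E] [MeasurableSpace E] [MeasurableSingletonClass E] {n : ℕ} {Y : Set E}
    (hYc : IsClosed Y) (hYconv : Convex ℝ Y) {p ε : ℝ} (hp : 1 ≤ p) (hε : 0 ≤ ε)
    {w : Fin n → ℝ} (hw : ∀ i, 0 ≤ w i) (hw1 : ∑ i, w i = 1)
    (hY : Y.Nonempty) {y : Fin n → E} (hy : ∀ i, y i ∈ Y) {f : E → ℝ} {L : ℝ≥0}
    (hf : LipschitzOnWith L f Y) (hfc : ConcaveOn ℝ Y f) :
    ∃ ξ : Fin n → E, (∀ i, ξ i ∈ Y) ∧ ∑ i, w i * ‖ξ i - y i‖ ^ p ≤ ε ^ p ∧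
      dualValue Y p ε (weightedEmpirical w y) f ≤ ((∑ i, w i * f (ξ i) : ℝ) : EReal) ∧
      (0 < ε → ∃ lam : ℝ, 0 ≤ lam ∧ dualObjective Y p ε (weightedEmpirical w y) f lam ≤
        ((∑ i, w i * f (ξ i) : ℝ) : EReal)) := by
  obtain ⟨ξ, hξ, hcost, hmax⟩ := exists_perturbation_maximizer hYc hp hw hy hf.continuousOn
    (Real.rpow_nonneg hε p)
  have hpos : 0 < ε → ∃ lam : ℝ, 0 ≤ lam ∧
      dualObjective Y p ε (weightedEmpirical w y) f lam ≤
        ((∑ i, w i * f (ξ i) : ℝ) : EReal) := fun hε' => by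
    obtain ⟨lam, b, hlam, hb, hle⟩ := exists_dual_multiplier hYconv hp hw hy hfc
      (Real.rpow_pos_of_pos hε' p) hξ hcost hmax
    exact ⟨lam, hlam, (dualObjective_le hY hw hb).trans (EReal.coe_le_coe_iff.2 hle)⟩
  refine ⟨ξ, hξ, hcost, ?_, hpos⟩
  rcases hε.eq_or_lt with rfl | hε'
  · refine (dualValue_le_of_radius_zero hp hw hw1 hY hy hf).trans
      (EReal.coe_le_coe_iff.2 (hmax y hy ?_))
    simp [Real.zero_rpow (by linarith : p ≠ 0)]
  · obtain ⟨lam, hlam, hle⟩ := hpos hε'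
    exact (iInf₂_le lam hlam).trans hle

end KernelDRO

/-! ### Kernel weights and the main theorem. -/

namespace KernelDRO

theorem nwWeight_nonneg {dx n : ℕ} {K : EuclideanSpace ℝ (Fin dx) → ℝ} (hK : ∀ u, 0 ≤ K u) (h : ℝ)
    (xs : Fin n → EuclideanSpace ℝ (Fin dx)) (x : EuclideanSpace ℝ (Fin dx)) (i : Fin n) :
    0 ≤ nwWeight K h xs x i :=
  div_nonneg (hK _) (Finset.sum_nonneg fun _ _ => hK _)

theorem sum_nwWeight {dx n : ℕ} {K : EuclideanSpace ℝ (Fin dx) → ℝ} {h : ℝ}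
    {xs : Fin n → EuclideanSpace ℝ (Fin dx)} {x : EuclideanSpace ℝ (Fin dx)}
    (hpos : 0 < ∑ j, K (h⁻¹ • (x - xs j))) : ∑ i, nwWeight K h xs x i = 1 := by
  simp only [nwWeight, ← Finset.sum_div]
  exact div_self hpos.ne'

end KernelDRO

open KernelDRO

theorem mainTheorem5
    {D E : Type*} [TopologicalSpace D]
    [NormedAddCommGroup E] [NormedSpace ℝ E] [FiniteDimensional ℝ E]
    [MeasurableSpace E] [BorelSpace E]
    (Z : Set D) (Y : Set E) (c : D → E → ℝ) (p : ℝ) (hp : 1 ≤ p)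
    (hc : KernelDRO.CostAssumption Z Y c p)
    {dx n : ℕ} (K : EuclideanSpace ℝ (Fin dx) → ℝ) (hK : ∀ u, 0 ≤ K u)
    (h : ℝ) (hh : 0 < h)
    (xs : Fin n → EuclideanSpace ℝ (Fin dx)) (x : EuclideanSpace ℝ (Fin dx))
    (hpos : 0 < ∑ j, K (h⁻¹ • (x - xs j)))
    (y : Fin n → E) (hy : ∀ i, y i ∈ Y)
    (ε : ℝ) (hε : 0 ≤ ε)
    (w : Fin n → ℝ) (hw : w = KernelDRO.nwWeight K h xs x)
    (ν : MeasureTheory.Measure E) (hν : ν = KernelDRO.weightedEmpirical w y)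
    (z : D) (hz : z ∈ Z) :
    -- all expectations in the primal problem are well defined
    (∀ μ ∈ KernelDRO.wassersteinBall Y p ε ν, MeasureTheory.Integrable (c z) μ) ∧
    -- strong duality and the finite-dimensional reformulation
    KernelDRO.primalValue Y p ε ν (c z) = KernelDRO.dualValue Y p ε ν (c z) ∧
    KernelDRO.primalValue Y p ε ν (c z) =
      (⨅ lam ∈ Set.Ici (0 : ℝ), (((lam * ε ^ p : ℝ) : EReal) +
        ∑ i, ((w i : ℝ) : EReal) *
          ⨆ v ∈ Y, ((c z v - lam * ‖v - y i‖ ^ p : ℝ) : EReal))) ∧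
    KernelDRO.primalValue Y p ε ν (c z) = KernelDRO.perturbationValue Y p ε w y (c z) ∧
    -- the dual objective has the displayed form, and the dual problem has a minimizer
    (∀ lam : ℝ, 0 ≤ lam → KernelDRO.dualObjective Y p ε ν (c z) lam =
      ((lam * ε ^ p : ℝ) : EReal) +
        ∑ i, ((w i : ℝ) : EReal) *
          ⨆ v ∈ Y, ((c z v - lam * ‖v - y i‖ ^ p : ℝ) : EReal)) ∧
    (0 < ε → ∃ lam : ℝ, 0 ≤ lam ∧
      IsMinOn (KernelDRO.dualObjective Y p ε ν (c z)) (Set.Ici 0) lam) ∧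
    -- a worst-case distribution exists and has the stated form
    (∃ (i₀ : Fin n) (wstar : ℝ) (ystar : Fin n → E) (y₁ y₂ : E)
        (μ : MeasureTheory.Measure E),
      wstar ∈ Set.Icc 0 (w i₀) ∧
      (∀ i, ystar i ∈ Y) ∧ y₁ ∈ Y ∧ y₂ ∈ Y ∧
      μ = ∑ i ∈ Finset.univ.erase i₀,
            ENNReal.ofReal (w i) • MeasureTheory.Measure.dirac (ystar i)
          + ENNReal.ofReal wstar • MeasureTheory.Measure.dirac y₁
          + ENNReal.ofReal (w i₀ - wstar) • MeasureTheory.Measure.dirac y₂ ∧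
      (∃ S : Finset E, S.card ≤ n + 1 ∧ μ (↑S : Set E)ᶜ = 0) ∧
      μ ∈ KernelDRO.wassersteinBall Y p ε ν ∧
      ((∫ v, c z v ∂μ : ℝ) : EReal) = KernelDRO.primalValue Y p ε ν (c z) ∧
      (∀ lam : ℝ, 0 ≤ lam → IsMinOn (KernelDRO.dualObjective Y p ε ν (c z)) (Set.Ici 0) lam →
        (∀ i, i ≠ i₀ → w i ≠ 0 → ystar i ∈ KernelDRO.innerArgmin Y p (c z) lam (y i)) ∧
        y₁ ∈ KernelDRO.innerArgmin Y p (c z) lam (y i₀) ∧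
        y₂ ∈ KernelDRO.innerArgmin Y p (c z) lam (y i₀))) := by
  obtain ⟨L, hL⟩ := hc.lipschitz z hz
  have hw0 : ∀ i, 0 ≤ w i := fun i => hw ▸ nwWeight_nonneg hK h xs x i
  have hw1 : ∑ i, w i = 1 := hw ▸ sum_nwWeight hpos
  clear hw hpos hK hh
  -- The index `i₀` must carry mass, since the argmin conditions on `y₁` and `y₂` are required
  -- without any condition on its weight.
  obtain ⟨i₀, hi₀⟩ : ∃ i, w i ≠ 0 := by
    by_contra! hall
    simp [hall] at hw1
  have hY : Y.Nonempty := ⟨y i₀, hy i₀⟩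
  obtain ⟨ξ, hξ, hcost, hdual, hatt⟩ :=
    exists_optimal_perturbation hc.isClosed hc.convex hp hε hw0 hw1 hY hy hL (hc.concave z hz)
  have hform := dualObjective_eq hY p ε hw0 y (c z)
  have hp0 : 0 < p := by linarith
  have hfeas : ∀ ζ : Fin n → E, (∀ i, ζ i ∈ Y) → ∑ i, w i * ‖ζ i - y i‖ ^ p ≤ ε ^ p →
      ((∑ i, w i * c z (ζ i) : ℝ) : EReal) ≤ primalValue Y p ε ν (c z) := fun ζ hζ hζc => by
    rw [← integral_weightedEmpirical hw0 ζ (c z), hν]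
    exact le_iSup₂ (f := fun (μ : MeasureTheory.Measure E)
      (_ : μ ∈ wassersteinBall Y p ε (weightedEmpirical w y)) => ((∫ v, c z v ∂μ : ℝ) : EReal)) _
      (weightedEmpirical_mem_wassersteinBall hp0 hw0 hw1 hε hζ hζc)
  have hweak : primalValue Y p ε ν (c z) ≤ dualValue Y p ε ν (c z) := by
    subst hν
    refine iSup₂_le fun μ hμ => le_iInf₂ fun lam hlam => ?_
    rcases dualObjective_cases hY p ε hw0 y (c z) lam with htop | ⟨g, hg, heq⟩
    · rw [htop]
      exact le_top
    · rw [heq, EReal.coe_le_coe_iff]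
      exact integral_le_of_mem_wassersteinBall hc.isClosed hp hL (hy i₀) hw0 hε hμ hlam hg
  have hopt : primalValue Y p ε ν (c z) = ((∑ i, w i * c z (ξ i) : ℝ) : EReal) :=
    le_antisymm (hweak.trans (hν ▸ hdual)) (hfeas ξ hξ hcost)
  have hstrong : primalValue Y p ε ν (c z) = dualValue Y p ε ν (c z) :=
    le_antisymm hweak (hopt ▸ hν ▸ hdual)
  refine ⟨fun μ hμ => ?_, hstrong, ?_, ?_, fun lam _ => ?_, fun hε' => ?_, ?_⟩
  · exact integrable_of_mem_wassersteinBall hc.isClosed hp hL (hy i₀) hε (hν ▸ hμ)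
  · rw [hstrong, dualValue, hν]
    simp only [hform, penalizedSup]
  · refine le_antisymm ?_ (iSup₂_le fun ζ hζ => hfeas ζ hζ.1 hζ.2)
    rw [hopt]
    exact le_iSup₂ (f := fun (ζ : Fin n → E)
      (_ : ζ ∈ {ζ : Fin n → E | (∀ i, ζ i ∈ Y) ∧ ∑ i, w i * ‖ζ i - y i‖ ^ p ≤ ε ^ p}) =>
        ((∑ i, w i * c z (ζ i) : ℝ) : EReal)) ξ ⟨hξ, hcost⟩
  · rw [hν]
    exact hform lam
  · obtain ⟨lam, hlam, hle⟩ := hatt hε'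
    rw [← hν, ← hopt, hstrong] at hle
    exact ⟨lam, hlam, fun lam' hlam' => hle.trans (iInf₂_le lam' hlam')⟩
  -- The split is degenerate: `wstar = w i₀` and `y₁ = y₂ = ξ i₀`, so the second piece has mass
  -- zero.
  · have hsplit : weightedEmpirical w ξ = ∑ i ∈ Finset.univ.erase i₀,
          ENNReal.ofReal (w i) • MeasureTheory.Measure.dirac (ξ i)
        + ENNReal.ofReal (w i₀) • MeasureTheory.Measure.dirac (ξ i₀)
        + ENNReal.ofReal (w i₀ - w i₀) • MeasureTheory.Measure.dirac (ξ i₀) := by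
      rw [sub_self, ENNReal.ofReal_zero, zero_smul, add_zero, weightedEmpirical,
        Finset.sum_erase_add _ _ (Finset.mem_univ i₀)]
    -- Any minimizer has objective equal to the common optimal value, so this also covers `ε = 0`
    -- whenever a minimizer exists.
    have hslack : ∀ lam : ℝ, 0 ≤ lam → IsMinOn (dualObjective Y p ε ν (c z)) (Set.Ici 0) lam →
        ∀ i, w i ≠ 0 → ξ i ∈ innerArgmin Y p (c z) lam (y i) := fun lam hlam hmin i hi => by
      refine mem_innerArgmin_of_dualObjective_le (ε := ε) hw0 hlam hξ hcost ?_ hi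
      rw [← hopt, hstrong, ← hν]
      exact le_iInf₂ fun lam' hlam' => hmin hlam'
    classical
    refine ⟨i₀, w i₀, ξ, ξ i₀, ξ i₀, weightedEmpirical w ξ, ⟨hw0 i₀, le_rfl⟩, hξ, hξ i₀, hξ i₀,
      hsplit, ⟨Finset.univ.image ξ, ?_, ?_⟩, ?_, ?_, fun lam hlam hmin => ?_⟩
    · exact Finset.card_image_le.trans (by simp)
    · exact weightedEmpirical_eq_zero w ξ fun i _ hi => hi (by simp)
    · exact hν ▸ weightedEmpirical_mem_wassersteinBall hp0 hw0 hw1 hε hξ hcost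
    · rw [hopt, integral_weightedEmpirical hw0]
    · exact ⟨fun i _ hi => hslack lam hlam hmin i hi, hslack lam hlam hmin i₀ hi₀,
        hslack lam hlam hmin i₀ hi₀⟩
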